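/- Let $k$ be a field of characteristic $0$, let $F=k((t))$, and let $\Omega^1_F=F\,dt$ be the one-dimensional $F$-vector space of continuous differential forms, with $d\colon F\to\Omega^1_F$, $df=\frac{df}{dt}\,dt$. Let $E$ be a finite-dimensional $F$-vector space and let $\nabla\colon E\to E\otimes_F\Omega^1_F$ be a (flat) connection, i.e. a $k$-linear map with $\nabla(fe)=f\nabla(e)+e\otimes df$ for all $f\in F$, $e\in E$ (flatness is automatic in one variable). Endow $E$ and $E\otimes_F\Omega^1_F$ with their $t$-adic topologies. A topological vector space over the discrete field $k$ is called linearly compact if it is Hausdorff, has a neighbourhood basis of $0$ consisting of linear subspaces, and is the inverse limit of its quotients by open subspaces, all of which are finite-dimensional. It is called a Tate (linearly locally compact) $k$-vector space if it is Hausdorff, has a neighbourhood basis of $0$ consisting of linear subspaces, and has an open linearly compact subspace. Let $\mathsf{Tate}^{el}(k)$ be the category of Tate $k$-vector spaces and continuous $k$-linear maps, let $\mathsf{Pro}^a(k)$ be its full subcategory of linearly compact spaces, and let $\mathsf{Tate}^{el}(k)/\mathsf{Pro}^a(k)$ be the localisation of $\mathsf{Tate}^{el}(k)$ at the closed embeddings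 with linearly compact cokernel and the open surjections with linearly compact kernel. Then: 1. $E$ and $E\otimes_F\Omega^1_F$ are Tate $k$-vector spaces, and $\nabla$ is continuous, i.e. a morphism of $\mathsf{Tate}^{el}(k)$. 2. $\ker\nabla$ is finite-dimensional over $k$ and discrete in the subspace topology, and the inclusion $\ker\nabla\hookrightarrow E$ has a continuous $k$-linear retraction. 3. $\operatorname{coker}\nabla$ is finite-dimensional over $k$ and discrete in the quotient topology, and the projection $E\otimes_F\Omega^1_F\twoheadrightarrow\operatorname{coker}\nabla$ has a continuous $k$-linear section. 4. The image of $\nabla$ in $\mathsf{Tate}^{el}(k)/\mathsf{Pro}^a(k)$ is an isomorphism. -/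

import Mathlib

open CategoryTheory Topology
open scoped LaurentSeries TensorProduct

universe u

namespace FormalConnection

noncomputable section

/-! ### Differential forms and connections on the field of Laurent series -/

/-- The space `Ω¹` of (continuous) differential forms of `F = k((t))` over the constants `k`:
the one-dimensional `F`-vector space with basis `dt`. The Laurent series `f` stands for the
form `f dt`. -/
def Form (k : Type u) [Field k] : Type u := k⸨X⸩

instance (k : Type u) [Field k] : AddCommGroup (Form k) := inferInstanceAs (AddCommGroup k⸨X⸩)

instance (k : Type u) [Field k] : Module k⸨X⸩ (Form k) := inferInstanceAs (Module k⸨X⸩ k⸨X⸩)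

instance (k : Type u) [Field k] : Module k (Form k) := inferInstanceAs (Module k k⸨X⸩)

/-- The product rule for the formal derivative of Laurent series. -/
theorem derivative_mul (k : Type u) [Field k] (f g : k⸨X⸩) :
    LaurentSeries.derivative k (f * g) =
      f * LaurentSeries.derivative k g + g * LaurentSeries.derivative k f := by
  have hc : ∀ (h : k⸨X⸩) (n : ℤ),
      (HahnSeries.single (1 : ℤ) (1 : k) * LaurentSeries.derivative k h).coeff n =
        (n : k) * h.coeff n := by
    intro h n
    rw [HahnSeries.coeff_single_mul]
    simp [LaurentSeries.hasseDeriv_coeff]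
  have hs : ∀ h : k⸨X⸩,
      (HahnSeries.single (1 : ℤ) (1 : k) * LaurentSeries.derivative k h).support ⊆ h.support := by
    intro h n hn
    rw [HahnSeries.mem_support, hc] at hn
    exact right_ne_zero_of_mul hn
  have hT : HahnSeries.single (1 : ℤ) (1 : k) ≠ 0 := by simp
  apply mul_left_cancel₀ hT
  rw [mul_add, mul_left_comm, mul_comm g, ← mul_assoc _ (LaurentSeries.derivative k f)]
  ext n
  rw [hc, HahnSeries.coeff_add, HahnSeries.coeff_mul,
    HahnSeries.coeff_mul_right' g.isPWO_support (hs g),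
    HahnSeries.coeff_mul_left' f.isPWO_support (hs f), Finset.mul_sum, ← Finset.sum_add_distrib]
  refine Finset.sum_congr rfl fun p hp => ?_
  rw [hc, hc, ← (Finset.mem_antidiagonal.1 hp).2.2]
  push_cast
  ring

/-- The universal differential `d : k((t)) → Ω¹`, `f ↦ (df/dt) dt`, where `df/dt` is the
termwise derivative of the series. -/
def d (k : Type u) [Field k] : k⸨X⸩ →ₗ[k] Form k :=
  (LaurentSeries.derivative k : k⸨X⸩ →ₗ[k] k⸨X⸩)

/-- `d` is a derivation. -/
theorem d_mul (k : Type u) [Field k] (f g : k⸨X⸩) : d k (f * g) = f • d k g + g • d k f :=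
  derivative_mul k f g

/-- The actions of `k` and `k((t))` on a `k((t))`-vector space commute. -/
instance (k : Type u) [Field k] (E : Type u) [AddCommGroup E] [Module k E] [Module k⸨X⸩ E]
    [IsScalarTower k k⸨X⸩ E] : SMulCommClass k⸨X⸩ k E where
  smul_comm f a e := by
    have h : ∀ e : E, a • e = (a • (1 : k⸨X⸩)) • e := fun e => by rw [smul_assoc, one_smul]
    rw [h, h, smul_smul, smul_smul, mul_comm]

/-- A flat connection on the `k((t))`-vector space `E`: a `k`-linear map `∇ : E → E ⊗ Ω¹`
satisfying the Leibniz identity `∇(f e) = f ∇(e) + e ⊗ df`. As `Ω¹` has rank one over `k((t))`,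
there are no non-zero `2`-forms, so the curvature vanishes and every connection is flat. -/
structure Connection (k : Type u) [Field k] (E : Type u) [AddCommGroup E] [Module k E]
    [Module k⸨X⸩ E] [IsScalarTower k k⸨X⸩ E] where
  /-- the underlying `k`-linear map -/
  toLinearMap : E →ₗ[k] E ⊗[k⸨X⸩] Form k
  leibniz : ∀ (f : k⸨X⸩) (e : E),
    toLinearMap (f • e) = f • toLinearMap e + e ⊗ₜ[k⸨X⸩] d k f

/-- The `t`-adic topology on `E ⊗ Ω¹`. In Mathlib `k((t))` carries the topology of its `t`-adic
valuation; the module topology on a finite-dimensional `k((t))`-vector space is the product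
topology with respect to any basis. -/
instance (k : Type u) [Field k] (E : Type u) [AddCommGroup E] [Module k⸨X⸩ E] :
    TopologicalSpace (E ⊗[k⸨X⸩] Form k) :=
  moduleTopology k⸨X⸩ (E ⊗[k⸨X⸩] Form k)

instance (k : Type u) [Field k] (E : Type u) [AddCommGroup E] [Module k⸨X⸩ E] :
    IsModuleTopology k⸨X⸩ (E ⊗[k⸨X⸩] Form k) := ⟨rfl⟩

/-! ### Linearly compact and linearly locally compact (Tate) vector spaces -/

/-- A topological vector space `V` over the discrete field `k` is linearly compact: it is
Hausdorff, has a neighbourhood basis of `0` of linear subspaces, and is the inverse limit of its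
finite-dimensional discrete quotients `V/U`. These are the objects of `Pro^a(k)`. -/
structure IsLinearlyCompact (k : Type u) [Field k] (V : Type u) [AddCommGroup V] [Module k V]
    [TopologicalSpace V] : Prop where
  isTopologicalAddGroup : IsTopologicalAddGroup V
  t2Space : T2Space V
  isLinearTopology : IsLinearTopology k V
  /-- open subspaces have finite codimension -/
  finite_quotient : ∀ U : Submodule k V, IsOpen (U : Set V) → FiniteDimensional k (V ⧸ U)
  /-- completeness: every point of `lim V/U`, over the open subspaces `U`, comes from `V` -/
  complete : ∀ x : (∀ U : {U : Submodule k V // IsOpen (U : Set V)}, V ⧸ U.1),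
    (∀ (U₁ U₂ : {U : Submodule k V // IsOpen (U : Set V)}) (h : U₁.1 ≤ U₂.1),
      Submodule.factor h (x U₁) = x U₂) →
    ∃ v : V, ∀ U, Submodule.Quotient.mk v = x U

/-- A topological vector space `V` over the discrete field `k` is linearly locally compact, or a
Tate vector space: it is Hausdorff, linearly topologized, and has an open linearly compact
subspace `L` (a lattice); so `V` is an extension of the discrete space `V/L` by `L`. -/
structure IsTateSpace (k : Type u) [Field k] (V : Type u) [AddCommGroup V] [Module k V]
    [TopologicalSpace V] : Prop where
  isTopologicalAddGroup : IsTopologicalAddGroup V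
  t2Space : T2Space V
  isLinearTopology : IsLinearTopology k V
  exists_lattice : ∃ L : Submodule k V, IsOpen (L : Set V) ∧ IsLinearlyCompact k L

/-- The objects of the category `Tate^el(k)`: Tate vector spaces over `k`. -/
structure ElTate (k : Type u) [Field k] : Type (u + 1) where
  /-- the underlying vector space -/
  carrier : Type u
  [addCommGroup : AddCommGroup carrier]
  [module : Module k carrier]
  [topologicalSpace : TopologicalSpace carrier]
  isTateSpace : IsTateSpace k carrier

attribute [instance] ElTate.addCommGroup ElTate.module ElTate.topologicalSpace

/-- The morphisms of `Tate^el(k)` are the continuous `k`-linear maps. -/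
instance (k : Type u) [Field k] : Category (ElTate k) where
  Hom V W := V.carrier →L[k] W.carrier
  id V := ContinuousLinearMap.id k V.carrier
  comp f g := ContinuousLinearMap.comp g f

/-- A continuous linear map between Tate vector spaces, as a morphism of `Tate^el(k)`. -/
def ElTate.ofHom {k : Type u} [Field k] {V W : Type u} [AddCommGroup V] [Module k V]
    [TopologicalSpace V] [AddCommGroup W] [Module k W] [TopologicalSpace W]
    (hV : IsTateSpace k V) (hW : IsTateSpace k W) (f : V →L[k] W) :
    ElTate.mk V hV ⟶ ElTate.mk W hW :=
  f

/-- The continuous linear map underlying a morphism of `Tate^el(k)`. -/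
def ElTate.toMap {k : Type u} [Field k] {V W : ElTate k} (f : V ⟶ W) :
    V.carrier →L[k] W.carrier :=
  f

/-- The morphisms which are inverted in the quotient of the exact category `Tate^el(k)` by
`Pro^a(k)`: admissible monomorphisms (closed embeddings) whose cokernel lies in `Pro^a(k)`, and
admissible epimorphisms (open surjections) whose kernel lies in `Pro^a(k)`. -/
def proWeakIso (k : Type u) [Field k] : MorphismProperty (ElTate k) := fun _ W f =>
  (IsClosedEmbedding (ElTate.toMap f) ∧
    IsLinearlyCompact k (W.carrier ⧸ LinearMap.range (ElTate.toMap f).toLinearMap)) ∨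
  (IsOpenQuotientMap (ElTate.toMap f) ∧
    IsLinearlyCompact k (LinearMap.ker (ElTate.toMap f).toLinearMap))

/-- The localised category `Tate^el(k) / Pro^a(k)`. -/
abbrev ElTateModPro (k : Type u) [Field k] := (proWeakIso k).Localization

/-- The localisation functor `Tate^el(k) ⥤ Tate^el(k) / Pro^a(k)`. -/
abbrev toElTateModPro (k : Type u) [Field k] : ElTate k ⥤ ElTateModPro k := (proWeakIso k).Q

end

end FormalConnection

/-! Contracting with the Euler field `t d/dt` identifies `E ⊗ Ω¹` with `E` and turns `∇` into an
operator `D` with `D (f e) = f D e + θ(f) e`, where `θ = t d/dt` multiplies the coefficient of `tⁿ`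
by `n`.

Horizontal vectors independent over `k((t))` span, over `k`, all horizontal vectors in their
`k((t))`-span: `θ` kills the coefficients, which in characteristic `0` are then constants. So `ker
D` is finite-dimensional (`finiteDimensional_ker`).

For the image, fix `e`. Its iterates satisfy a relation `∑ aᵢ Dⁱ e = 0`, scaled so that the `aᵢ` are
integral and not all divisible by `t`. Integration by parts gives `((-θ)ⁱ f) e ≡ f Dⁱ e` modulo `D
E`, so `P f = ∑ (-θ)ⁱ (aᵢ f)` satisfies `(P f) e ∈ D E`, with a preimage continuous in `f`
(`exists_isGraded`). On the graded piece of degree `m`, `P` is the scalar `p(-m)`, where `p = ∑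
aᵢ(0) Xⁱ ≠ 0`. This vanishes for only finitely many `m`, so by completeness `P` is open with
finite-dimensional cokernel. Taking `e` through a basis of `E`, the same follows for `D`.

The image of `∇` is thus open, with finite-dimensional discrete cokernel. A small lattice misses the
finite-dimensional kernel, which is therefore discrete and split. Finally, `∇` is an open surjection
followed by a closed embedding, and finite-dimensional discrete spaces are linearly compact. -/

namespace FormalConnection

/-! ### Graded operators on Laurent series -/

section Laurent

variable {k : Type u} [Field k]

instance isScalarTower_laurentSeries : IsScalarTower k k⸨X⸩ k⸨X⸩ where
  smul_assoc a f g := by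
    rw [smul_eq_mul, smul_eq_mul, ← HahnSeries.C_mul_eq_smul, ← HahnSeries.C_mul_eq_smul,
      mul_assoc]

instance smulCommClass_laurentSeries : SMulCommClass k k⸨X⸩ k⸨X⸩ := SMulCommClass.symm ..

/-- The `k`-subspace `tⁿ k[[t]]` of `k((t))`. -/
def seriesFrom (k : Type u) [Field k] (n : ℤ) : Submodule k k⸨X⸩ where
  carrier := {f | ∀ m < n, f.coeff m = 0}
  add_mem' {f g} hf hg m hm := by simp [hf m hm, hg m hm]
  zero_mem' := by simp
  smul_mem' a f hf m hm := by simp [hf m hm]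

theorem seriesFrom_anti {m n : ℤ} (h : m ≤ n) : seriesFrom k n ≤ seriesFrom k m :=
  fun _ hf i hi => hf i (hi.trans_le h)

theorem single_mem_seriesFrom (n : ℤ) (a : k) : HahnSeries.single n a ∈ seriesFrom k n :=
  fun _ hm => HahnSeries.coeff_single_of_ne hm.ne

theorem mem_seriesFrom_order (f : k⸨X⸩) : f ∈ seriesFrom k f.order :=
  fun _ hm => HahnSeries.coeff_eq_zero_of_lt_order hm

theorem mem_seriesFrom_succ {n : ℤ} {f : k⸨X⸩} :
    f ∈ seriesFrom k (n + 1) ↔ f ∈ seriesFrom k n ∧ f.coeff n = 0 := by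
  refine ⟨fun h => ⟨seriesFrom_anti (by lia) h, h n (by lia)⟩, fun h m hm => ?_⟩
  rcases (Int.lt_add_one_iff.1 hm).lt_or_eq with h' | rfl
  exacts [h.1 m h', h.2]

theorem mem_seriesFrom_iff_pred {n : ℤ} {f : k⸨X⸩} :
    f ∈ seriesFrom k n ↔ f ∈ seriesFrom k (n - 1) ∧ f.coeff (n - 1) = 0 := by
  rw [← mem_seriesFrom_succ, sub_add_cancel]

theorem hasBasis_nhds_zero_seriesFrom :
    (𝓝 (0 : k⸨X⸩)).HasBasis (fun _ : ℤ => True) fun n => (seriesFrom k n : Set k⸨X⸩) := by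
  refine (Valued.hasBasis_nhds_zero k⸨X⸩ _).to_hasBasis (fun γ _ => ?_) fun n _ => ?_
  · have hγ : MonoidWithZeroHom.ValueGroup₀.embedding γ.1 ≠ 0 := by simp
    -- The basic neighbourhoods of the valuation are strict, `v f < γ`, while `tⁿ k[[t]]` is `v f ≤
    -- exp (-n)`; hence the shift of `log γ` by one.
    refine ⟨-(WithZero.log (MonoidWithZeroHom.ValueGroup₀.embedding γ.1) - 1), trivial,
      fun f hf => ?_⟩
    rw [Set.mem_ofPred_eq, Valuation.restrict_lt_iff_lt_embedding]
    refine ((LaurentSeries.valuation_le_iff_coeff_lt_eq_zero k).2 hf).trans_lt ?_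
    rw [neg_neg, ← WithZero.lt_log_iff_exp_lt hγ]
    lia
  · have hv : Valued.v (HahnSeries.single n (1 : k)) = WithZero.exp (-n) :=
      LaurentSeries.valuation_single_zpow k n
    have h : Valued.v.restrict (HahnSeries.single n (1 : k)) ≠ 0 := by simp
    refine ⟨Units.mk0 _ h, trivial, fun f hf => ?_⟩
    have hf' := Valuation.restrict_lt_iff _ |>.1 hf
    rw [hv] at hf'
    exact (LaurentSeries.valuation_le_iff_coeff_lt_eq_zero k).1 hf'.le

theorem sub_mem_of_antitone {V : Type*} [AddCommGroup V] [Module k V]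
    {L : ℕ → Submodule k V} (hL : Antitone L) {v : ℕ → V} (hv : ∀ j, v (j + 1) - v j ∈ L j)
    (i j : ℕ) :
    v (i + j) - v i ∈ L i := by
  induction j with
  | zero => simp
  | succ j ih =>
    rw [← sub_add_sub_cancel (v (i + (j + 1))) (v (i + j))]
    exact add_mem (hL (Nat.le_add_right i j) (hv (i + j))) ih

/-- `k((t))` is complete for the filtration by the powers of `t`. -/
theorem exists_limit (n : ℤ) (v : ℕ → k⸨X⸩)
    (hv : ∀ j : ℕ, v (j + 1) - v j ∈ seriesFrom k (n + j)) :
    ∃ w, ∀ j : ℕ, w - v j ∈ seriesFrom k (n + j) := by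
  have hle := sub_mem_of_antitone (L := fun j : ℕ => seriesFrom k (n + j))
    (fun _ _ hij => seriesFrom_anti (by lia)) hv
  -- The coefficient of degree `m` is constant along the sequence from index `m - n + 1` on. For `m
  -- < n` the truncation `toNat` gives index `0`, so the support is bounded below as that of `v 0`
  -- is.
  have hbdd : BddBelow (Function.support fun m : ℤ => (v (m - n + 1).toNat).coeff m) := by
    refine ⟨min (v 0).order n, fun m hm => ?_⟩
    by_contra! h
    obtain ⟨h1, h2⟩ := lt_min_iff.1 h
    refine hm ?_
    simp only [show (m - n + 1).toNat = 0 by lia]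
    exact mem_seriesFrom_order _ m h1
  refine ⟨HahnSeries.ofSuppBddBelow _ hbdd, fun j m hm => ?_⟩
  obtain ⟨i, hi⟩ := Nat.exists_eq_add_of_le (show (m - n + 1).toNat ≤ j by lia)
  have := hle (m - n + 1).toNat i m (by lia)
  rw [← hi, HahnSeries.coeff_sub, sub_eq_zero] at this
  simp [this]

/-- A `k`-linear endomorphism of `k((t))` which preserves the filtration by the powers of `t`
and acts as the scalar `c n` on the `n`-th graded piece. -/
structure IsGraded (T : k⸨X⸩ →ₗ[k] k⸨X⸩) (c : ℤ → k) : Prop where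
  map_mem : ∀ n, ∀ f ∈ seriesFrom k n, T f ∈ seriesFrom k n
  coeff_eq : ∀ n, ∀ f ∈ seriesFrom k n, (T f).coeff n = c n * f.coeff n

namespace IsGraded

variable {T T' : k⸨X⸩ →ₗ[k] k⸨X⸩} {c c' : ℤ → k}

theorem comp (h : IsGraded T c) (h' : IsGraded T' c') : IsGraded (T ∘ₗ T') (c * c') where
  map_mem n f hf := h.map_mem n _ (h'.map_mem n f hf)
  coeff_eq n f hf := by
    rw [LinearMap.comp_apply, h.coeff_eq n _ (h'.map_mem n f hf), h'.coeff_eq n f hf,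
      Pi.mul_apply, mul_assoc]

theorem id : IsGraded (LinearMap.id : k⸨X⸩ →ₗ[k] k⸨X⸩) 1 where
  map_mem _ _ hf := hf
  coeff_eq _ _ _ := by simp

theorem neg (h : IsGraded T c) : IsGraded (-T) (-c) where
  map_mem n f hf := neg_mem (h.map_mem n f hf)
  coeff_eq n f hf := by simp [h.coeff_eq n f hf]

theorem pow (h : IsGraded T c) (i : ℕ) : IsGraded (T ^ i) (c ^ i) := by
  induction i with
  | zero =>
    rw [pow_zero, pow_zero]
    exact IsGraded.id
  | succ i ih =>
    rw [pow_succ, pow_succ]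
    exact ih.comp h

theorem sum {ι : Type*} (s : Finset ι) {T : ι → k⸨X⸩ →ₗ[k] k⸨X⸩} {c : ι → ℤ → k}
    (h : ∀ i ∈ s, IsGraded (T i) (c i)) : IsGraded (∑ i ∈ s, T i) (∑ i ∈ s, c i) where
  map_mem n f hf := by
    rw [LinearMap.sum_apply]
    exact sum_mem fun i hi => (h i hi).map_mem n f hf
  coeff_eq n f hf := by
    rw [LinearMap.sum_apply, HahnSeries.coeff_sum, Finset.sum_apply, Finset.sum_mul]
    exact Finset.sum_congr rfl fun i hi => (h i hi).coeff_eq n f hf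

theorem mulLeft {a : k⸨X⸩} (ha : a ∈ seriesFrom k 0) :
    IsGraded (LinearMap.mulLeft k a) fun _ => a.coeff 0 := by
  have key : ∀ n, ∀ f ∈ seriesFrom k n, a * f - a.coeff 0 • f ∈ seriesFrom k (n + 1) := by
    intro n f hf m hm
    have hs : f.support ⊆ Set.Ici n := fun i hi => by
      by_contra h
      exact hi (hf i (by simpa using h))
    have hs' : a.support ⊆ Set.Ici 0 := fun i hi => by
      by_contra h
      exact hi (ha i (by simpa using h))
    rw [HahnSeries.coeff_sub, HahnSeries.coeff_smul, HahnSeries.coeff_mul, smul_eq_mul,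
      sub_eq_zero]
    rw [Finset.sum_eq_single (0, m)]
    · rintro ⟨i, j⟩ hij hne
      simp only [Finset.mem_antidiagonal] at hij
      have h1 := hs' hij.1
      have h2 := hs hij.2.1
      simp only [Set.mem_Ici] at h1 h2
      exact absurd (Prod.ext (by simp; lia) (by simp; lia)) hne
    · intro h
      simp only [Finset.mem_antidiagonal, HahnSeries.mem_support] at h
      by_contra hne
      exact h ⟨left_ne_zero_of_mul hne, right_ne_zero_of_mul hne, by simp⟩
  refine ⟨fun n f hf => ?_, fun n f hf => ?_⟩
  · have := add_mem (seriesFrom_anti (by lia) (key n f hf))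
      ((seriesFrom k n).smul_mem (a.coeff 0) hf)
    simpa using this
  · have := key n f hf n (by lia)
    simpa [sub_eq_zero] using this

protected theorem continuous (h : IsGraded T c) : Continuous T := by
  refine continuous_of_continuousAt_zero T ?_
  rw [ContinuousAt, map_zero,
    hasBasis_nhds_zero_seriesFrom.tendsto_iff hasBasis_nhds_zero_seriesFrom]
  exact fun n _ => ⟨n, trivial, h.map_mem n⟩

/-- Successive approximation: each step divides the leading coefficient of the error by the non-zero
scalar `c`, and the corrections converge. -/
theorem seriesFrom_le_map (h : IsGraded T c) {n : ℤ} (hc : ∀ m, n ≤ m → c m ≠ 0) :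
    seriesFrom k n ≤ (seriesFrom k n).map T := by
  intro g hg
  let v : ℕ → k⸨X⸩ := fun j => Nat.rec 0
    (fun j f => f + HahnSeries.single (n + j) ((c (n + j))⁻¹ * (g - T f).coeff (n + j))) j
  have hsucc : ∀ j : ℕ, v (j + 1) = v j +
    HahnSeries.single (n + j) ((c (n + j))⁻¹ * (g - T (v j)).coeff (n + j)) := fun j => rfl
  have hv : ∀ j : ℕ, v (j + 1) - v j ∈ seriesFrom k (n + j) := fun j => by
    rw [hsucc, add_sub_cancel_left]
    exact single_mem_seriesFrom _ _
  have hg : ∀ j : ℕ, g - T (v j) ∈ seriesFrom k (n + j) := fun j => by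
    induction j with
    | zero => simpa [v] using hg
    | succ j ih =>
      rw [Nat.cast_succ, ← add_assoc, mem_seriesFrom_succ, hsucc, map_add, ← sub_sub]
      refine ⟨sub_mem ih (h.map_mem _ _ (single_mem_seriesFrom _ _)), ?_⟩
      rw [HahnSeries.coeff_sub, h.coeff_eq _ _ (single_mem_seriesFrom _ _),
        HahnSeries.coeff_single_same, mul_inv_cancel_left₀ (hc _ (by lia)), sub_self]
  obtain ⟨w, hw⟩ := exists_limit n v hv
  refine ⟨w, by simpa [v] using hw 0, ?_⟩
  rw [eq_comm, ← sub_eq_zero]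
  ext m
  have : g - T w ∈ seriesFrom k (n + (m - n + 1).toNat) := by
    have := sub_mem (hg (m - n + 1).toNat) (h.map_mem _ _ (hw (m - n + 1).toNat))
    rwa [map_sub, sub_sub, add_sub_cancel] at this
  exact this m (by lia)

theorem exists_ge_ne_zero (hc : {m | c m = 0}.Finite) (n : ℤ) :
    ∃ N, n ≤ N ∧ ∀ m, N ≤ m → c m ≠ 0 := by
  obtain ⟨b, hb⟩ := hc.bddAbove
  exact ⟨max n (b + 1), le_max_left _ _, fun m hm h0 => by have := hb h0; lia⟩

theorem map_mem_nhds (h : IsGraded T c) (hc : {m | c m = 0}.Finite) {U : Set k⸨X⸩}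
    (hU : U ∈ 𝓝 0) : T '' U ∈ 𝓝 0 := by
  obtain ⟨n, -, hn⟩ := hasBasis_nhds_zero_seriesFrom.mem_iff.1 hU
  obtain ⟨N, hnN, hN⟩ := exists_ge_ne_zero hc n
  exact hasBasis_nhds_zero_seriesFrom.mem_iff.2 ⟨N, trivial, fun f hf =>
    Set.image_mono (fun g hg => hn (seriesFrom_anti hnN hg)) (h.seriesFrom_le_map hN hf)⟩

theorem exists_finite_sup_eq_top (h : IsGraded T c) (hc : {m | c m = 0}.Finite) :
    ∃ S : Submodule k k⸨X⸩, FiniteDimensional k S ∧ LinearMap.range T ⊔ S = ⊤ := by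
  let S : Submodule k k⸨X⸩ :=
    Submodule.span k ((fun m : ℤ => HahnSeries.single m (1 : k)) '' {m | c m = 0})
  refine ⟨S, FiniteDimensional.span_of_finite k (hc.image _), eq_top_iff.2 fun f _ => ?_⟩
  obtain ⟨N, hfN, hN⟩ := exists_ge_ne_zero hc f.order
  -- Downward induction from `N`, above which `T` is onto. The coefficient of degree `n - 1` is
  -- removed by a monomial of `S` if `c` vanishes there, and by a value of `T` otherwise.
  have key : ∀ n ≤ N, seriesFrom k n ≤ LinearMap.range T ⊔ S := by
    intro n hn
    induction n, hn using Int.leInductionDown with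
    | base => exact (h.seriesFrom_le_map hN).trans (LinearMap.map_le_range.trans le_sup_left)
    | pred n hn ih =>
      intro g hg
      by_cases hz : c (n - 1) = 0
      · have hs : HahnSeries.single (n - 1) (g.coeff (n - 1)) ∈ S := by
          have := S.smul_mem (g.coeff (n - 1)) (Submodule.subset_span ⟨n - 1, hz, rfl⟩)
          convert this using 1
          ext m
          by_cases hm : m = n - 1 <;> simp [hm]
        have hg' : g - HahnSeries.single (n - 1) (g.coeff (n - 1)) ∈ seriesFrom k n := by
          rw [mem_seriesFrom_iff_pred]
          exact ⟨sub_mem hg (single_mem_seriesFrom _ _), by simp⟩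
        simpa using add_mem (ih hg') (Submodule.mem_sup_right hs)
      · set s := HahnSeries.single (n - 1) ((c (n - 1))⁻¹ * g.coeff (n - 1)) with hs
        have hsm : s ∈ seriesFrom k (n - 1) := single_mem_seriesFrom _ _
        have hg' : g - T s ∈ seriesFrom k n := by
          rw [mem_seriesFrom_iff_pred]
          refine ⟨sub_mem hg (h.map_mem _ _ hsm), ?_⟩
          rw [HahnSeries.coeff_sub, h.coeff_eq _ _ hsm, hs, HahnSeries.coeff_single_same,
            mul_inv_cancel_left₀ hz, sub_self]
        simpa using add_mem (ih hg') (Submodule.mem_sup_left ⟨s, rfl⟩)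
  exact key _ hfN (mem_seriesFrom_order f)

end IsGraded

/-- The Euler derivation `t d/dt` of `k((t))`. -/
noncomputable def euler (k : Type u) [Field k] : k⸨X⸩ →ₗ[k] k⸨X⸩ :=
  LinearMap.mulLeft k (HahnSeries.single 1 1) ∘ₗ LaurentSeries.derivative k

theorem euler_apply (f : k⸨X⸩) :
    euler k f = HahnSeries.single 1 1 * LaurentSeries.derivative k f := rfl

theorem euler_coeff (f : k⸨X⸩) (n : ℤ) : (euler k f).coeff n = n * f.coeff n := by
  rw [euler_apply, HahnSeries.coeff_single_mul]
  simp [LaurentSeries.hasseDeriv_coeff]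

theorem isGraded_euler : IsGraded (euler k) fun n => (n : k) where
  map_mem n f hf m hm := by rw [euler_coeff, hf m hm, mul_zero]
  coeff_eq n f _ := euler_coeff f n

theorem eq_smul_one_of_euler_eq_zero [CharZero k] {f : k⸨X⸩} (hf : euler k f = 0) :
    f = f.coeff 0 • (1 : k⸨X⸩) := by
  ext n
  have h := euler_coeff f n
  rw [hf, HahnSeries.coeff_zero, eq_comm, mul_eq_zero, Int.cast_eq_zero] at h
  rcases eq_or_ne n 0 with rfl | hn
  · simp
  · simp [HahnSeries.coeff_one, hn, h.resolve_left hn]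

/-- After scaling by a power of `t`, a non-zero polynomial over `k((t))` has integral
coefficients which are not all divisible by `t`. -/
theorem exists_normalized {n : ℕ} (a : Fin n → k⸨X⸩) (ha : a ≠ 0) :
    ∃ s : k⸨X⸩, (∀ i, s * a i ∈ seriesFrom k 0) ∧ ∃ i, (s * a i).coeff 0 ≠ 0 := by
  classical
  obtain ⟨i₁, hi₁⟩ := Function.ne_iff.1 ha
  obtain ⟨i₀, hi₀, hmin⟩ := Finset.exists_min_image (Finset.univ.filter fun i => a i ≠ 0)
    (fun i => (a i).order) ⟨i₁, by simpa using hi₁⟩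
  have hcoeff : ∀ i m, (HahnSeries.single (-(a i₀).order) (1 : k) * a i).coeff m =
      (a i).coeff (m + (a i₀).order) := fun i m => by
    rw [HahnSeries.coeff_single_mul]; simp
  refine ⟨HahnSeries.single (-(a i₀).order) 1, fun i m hm => ?_, i₀, ?_⟩
  · rw [hcoeff]
    by_cases hi : a i = 0
    · simp [hi]
    · have := hmin i (by simpa using hi)
      exact mem_seriesFrom_order _ _ (by lia)
  · rw [hcoeff, zero_add]
    simpa [HahnSeries.coeff_order_eq_zero] using hi₀

/-- The formal adjoint `∑ i, (-t d/dt)ⁱ aᵢ` of a differential operator `∑ i, aᵢ (t d/dt)ⁱ` with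
normalized coefficients acts on the graded pieces by a non-zero polynomial in the degree. -/
theorem exists_isGraded_adjoint [CharZero k] {n : ℕ} (a : Fin n → k⸨X⸩)
    (ha : ∀ i, a i ∈ seriesFrom k 0) (ha' : ∃ i, (a i).coeff 0 ≠ 0) :
    ∃ c : ℤ → k, {m | c m = 0}.Finite ∧
      IsGraded (∑ i : Fin n, ((-euler k) ^ (i : ℕ)) ∘ₗ LinearMap.mulLeft k (a i)) c := by
  refine ⟨_, ?_, IsGraded.sum _ fun i _ =>
    (isGraded_euler.neg.pow i).comp (IsGraded.mulLeft (ha i))⟩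
  -- The scalar in degree `m` is `p(-m)`, and `m ↦ -m` is injective into `k` in characteristic `0`.
  let p : Polynomial k := ∑ i : Fin n, Polynomial.monomial (i : ℕ) ((a i).coeff 0)
  have hp : p ≠ 0 := by
    obtain ⟨i, hi⟩ := ha'
    intro h
    apply hi
    have := congrArg (fun q => Polynomial.coeff q i) h
    simpa [p, Polynomial.finsetSum_coeff, Polynomial.coeff_monomial, Fin.val_inj] using this
  refine (Polynomial.finite_setOfPred_isRoot hp).preimage (f := fun m : ℤ => -(m : k))
    (fun x _ y _ h => by simpa using h) |>.subset fun m hm => ?_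
  simp only [Set.mem_ofPred_eq, Finset.sum_apply, Pi.mul_apply, Pi.pow_apply, Pi.neg_apply] at hm
  simp [p, Polynomial.IsRoot, Polynomial.eval_finsetSum, mul_comm, hm]

end Laurent

/-! ### Lattice filtrations, Tate spaces and the localisation -/

section LinearTopology

variable {k : Type u} [Field k] {V : Type u} [AddCommGroup V] [Module k V] [TopologicalSpace V]

/-- A descending sequence of subspaces which form a neighbourhood basis of `0`, have finite
codimension in the first one, and for which `V` is sequentially complete. -/
structure IsLatticeFiltration (k : Type u) [Field k] {V : Type u} [AddCommGroup V] [Module k V]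
    [TopologicalSpace V] (L : ℕ → Submodule k V) : Prop where
  antitone : Antitone L
  hasBasis : (𝓝 (0 : V)).HasBasis (fun _ : ℕ => True) fun n => (L n : Set V)
  finite : ∀ n, ∃ (ι : Type) (_ : Finite ι) (φ : V →ₗ[k] ι → k), ∀ v ∈ L 0, φ v = 0 → v ∈ L n
  exists_limit : ∀ v : ℕ → V, (∀ j, v (j + 1) - v j ∈ L j) → ∃ w, ∀ j, w - v j ∈ L j

theorem isOpen_of_mem_nhds_zero [IsTopologicalAddGroup V] {U : Submodule k V}
    (hU : (U : Set V) ∈ 𝓝 0) : IsOpen (U : Set V) :=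
  AddSubgroup.isOpen_of_mem_nhds U.toAddSubgroup hU

theorem continuous_of_isOpen_le_ker [IsTopologicalAddGroup V] {W : Type*} [AddCommGroup W]
    [Module k W] [TopologicalSpace W] [IsTopologicalAddGroup W] {U : Submodule k V}
    (hU : (U : Set V) ∈ 𝓝 0) (f : V →ₗ[k] W) (hf : U ≤ LinearMap.ker f) : Continuous f := by
  refine continuous_of_continuousAt_zero f ?_
  rw [ContinuousAt, map_zero]
  refine tendsto_const_nhds.congr' ?_
  filter_upwards [hU] with v hv
  exact (hf hv).symm

theorem isLinearlyCompact_of_finiteDimensional [DiscreteTopology V] [FiniteDimensional k V] :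
    IsLinearlyCompact k V where
  isTopologicalAddGroup := inferInstance
  t2Space := inferInstance
  isLinearTopology := inferInstance
  finite_quotient _ _ := inferInstance
  complete x hx := by
    obtain ⟨v, hv⟩ := Submodule.Quotient.mk_surjective _ (x ⟨⊥, isOpen_discrete _⟩)
    refine ⟨v, fun U => ?_⟩
    rw [← hx ⟨⊥, isOpen_discrete _⟩ U bot_le, ← hv]
    rfl

namespace IsLatticeFiltration

variable {L : ℕ → Submodule k V}

theorem isLinearTopology (h : IsLatticeFiltration k L) : IsLinearTopology k V :=
  IsLinearTopology.mk_of_hasBasis k h.hasBasis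

theorem mem_nhds (h : IsLatticeFiltration k L) (n : ℕ) : (L n : Set V) ∈ 𝓝 0 :=
  h.hasBasis.mem_of_mem trivial

theorem exists_le_of_isOpen (h : IsLatticeFiltration k L) {U : Submodule k V}
    (hU : IsOpen (U : Set V)) : ∃ n, L n ≤ U := by
  obtain ⟨n, -, hn⟩ := h.hasBasis.mem_iff.1 (hU.mem_nhds U.zero_mem)
  exact ⟨n, hn⟩

theorem isLinearlyCompact [IsTopologicalAddGroup V] [T2Space V] (h : IsLatticeFiltration k L)
    (h0 : L 0 = ⊤) : IsLinearlyCompact k V where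
  isTopologicalAddGroup := inferInstance
  t2Space := inferInstance
  isLinearTopology := h.isLinearTopology
  finite_quotient U hU := by
    obtain ⟨n, hn⟩ := h.exists_le_of_isOpen hU
    obtain ⟨ι, _, φ, hφ⟩ := h.finite n
    have hker : LinearMap.ker φ ≤ U := fun v hv => hn (hφ v (h0 ▸ trivial) hv)
    have : FiniteDimensional k (V ⧸ LinearMap.ker φ) :=
      Module.Finite.equiv φ.quotKerEquivRange.symm
    exact Module.Finite.of_surjective _ (Submodule.factor_surjective hker)
  complete x hx := by
    have hopen : ∀ n, IsOpen (L n : Set V) := fun n => isOpen_of_mem_nhds_zero (h.mem_nhds n)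
    choose v hv using fun n => Submodule.Quotient.mk_surjective _ (x ⟨L n, hopen n⟩)
    obtain ⟨w, hw⟩ := h.exists_limit v fun j => by
      rw [← Submodule.Quotient.eq, hv j,
        ← hx ⟨L (j + 1), hopen _⟩ ⟨L j, hopen j⟩ (h.antitone j.le_succ), ← hv (j + 1)]
      rfl
    refine ⟨w, fun U => ?_⟩
    obtain ⟨n, hn⟩ := h.exists_le_of_isOpen U.2
    rw [← hx ⟨L n, hopen n⟩ U hn, ← hv n, ← (Submodule.Quotient.eq (L n)).2 (hw n)]
    rfl

theorem comap_subtype (h : IsLatticeFiltration k L) {R : Submodule k V} {m : ℕ}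
    (hm : L m ≤ R) : IsLatticeFiltration k fun n => (L (n + m)).comap R.subtype where
  antitone _ _ hij := Submodule.comap_mono (h.antitone (by lia))
  hasBasis := by
    rw [nhds_subtype_eq_comap]
    refine (h.hasBasis.comap _).to_hasBasis (fun n _ => ⟨n, trivial, fun v hv => ?_⟩)
      fun n _ => ⟨n + m, trivial, subset_rfl⟩
    exact h.antitone (Nat.le_add_right n m) hv
  finite n := by
    obtain ⟨ι, hι, φ, hφ⟩ := h.finite (n + m)
    exact ⟨ι, hι, φ ∘ₗ R.subtype, fun v hv hv0 =>
      hφ _ (h.antitone (Nat.zero_le _) hv) hv0⟩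
  exists_limit v hv := by
    obtain ⟨w, hw⟩ := h.exists_limit (fun j => (v j : V)) fun j =>
      h.antitone (Nat.le_add_right j m) (hv j)
    have hw' : ∀ j, w - v j ∈ L (j + m) := fun j => by
      -- Index `j` only gives membership in `L j`; the detour through `v (j + m)` recovers `L (j +
      -- m)`.
      rw [← sub_add_sub_cancel w (v (j + m) : V)]
      refine add_mem (hw _) (sub_mem_of_antitone (L := fun n => L (n + m))
        (fun _ _ hij => h.antitone (by lia)) (v := fun j => (v j : V)) hv j m)
    have hwR : w ∈ R := by
      have := add_mem (hm (by simpa using hw' 0)) (v 0).2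
      simpa using this
    exact ⟨⟨w, hwR⟩, hw'⟩

theorem isTateSpace [IsTopologicalAddGroup V] [T2Space V] (h : IsLatticeFiltration k L) :
    IsTateSpace k V where
  isTopologicalAddGroup := inferInstance
  t2Space := inferInstance
  isLinearTopology := h.isLinearTopology
  exists_lattice := ⟨L 0, isOpen_of_mem_nhds_zero (h.mem_nhds 0),
    (h.comap_subtype (le_refl (L 0))).isLinearlyCompact (by simp)⟩

theorem isTateSpace_of_isOpen [IsTopologicalAddGroup V] [T2Space V]
    (h : IsLatticeFiltration k L) {R : Submodule k V} (hR : IsOpen (R : Set V)) :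
    IsTateSpace k R := by
  obtain ⟨m, hm⟩ := h.exists_le_of_isOpen hR
  exact (h.comap_subtype hm).isTateSpace

theorem eq_zero_of_forall_mem [T2Space V] (h : IsLatticeFiltration k L) {v : V}
    (hv : ∀ n, v ∈ L n) : v = 0 := by
  by_contra hne
  obtain ⟨n, -, hn⟩ := h.hasBasis.mem_iff.1 (isOpen_compl_singleton.mem_nhds (Ne.symm hne))
  exact hn (hv n) rfl

/-- The traces of the lattices on `K` form a descending chain, which stabilizes by finite dimension;
the stable value is zero because the space is Hausdorff. -/
theorem exists_disjoint_finiteDimensional [T2Space V] (h : IsLatticeFiltration k L)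
    (K : Submodule k V) [FiniteDimensional k K] : ∃ n, Disjoint (L n) K := by
  obtain ⟨n, hn⟩ := IsArtinian.monotone_stabilizes
    (⟨fun n => OrderDual.toDual ((L n).comap K.subtype), fun i j hij =>
      Submodule.comap_mono (h.antitone hij)⟩ : ℕ →o (Submodule k K)ᵒᵈ)
  refine ⟨n, Submodule.disjoint_def.2 fun v hv hvK => h.eq_zero_of_forall_mem fun m => ?_⟩
  rcases le_total n m with hnm | hmn
  · have : (⟨v, hvK⟩ : K) ∈ (L m).comap K.subtype := by
      have := OrderDual.toDual.injective (hn m hnm)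
      exact this ▸ hv
    exact this
  · exact h.antitone hmn hv

theorem discreteTopology_finiteDimensional [IsTopologicalAddGroup V] [T2Space V]
    (h : IsLatticeFiltration k L) (K : Submodule k V) [FiniteDimensional k K] :
    DiscreteTopology K := by
  obtain ⟨n, hn⟩ := h.exists_disjoint_finiteDimensional K
  refine discreteTopology_of_isOpen_singleton_zero ?_
  convert (isOpen_of_mem_nhds_zero (h.mem_nhds n)).preimage (continuous_subtype_val (p := (· ∈ K)))
  ext ⟨v, hv⟩
  simp only [Set.mem_singleton_iff, Set.mem_preimage, SetLike.mem_coe, Submodule.mk_eq_zero]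
  exact ⟨fun h => h ▸ zero_mem _, fun h => Submodule.disjoint_def.1 hn v h hv⟩

/-- A linear projection onto `K` whose kernel contains a lattice is automatically continuous. -/
theorem exists_retraction_finiteDimensional [IsTopologicalAddGroup V] [T2Space V]
    (h : IsLatticeFiltration k L) (K : Submodule k V) [FiniteDimensional k K] :
    ∃ r : V →L[k] K, ∀ x : K, r x = x := by
  obtain ⟨n, hn⟩ := h.exists_disjoint_finiteDimensional K
  obtain ⟨C, hC, hCK⟩ := hn.exists_isCompl
  refine ⟨⟨K.projectionOnto C hCK.symm, continuous_of_isOpen_le_ker (h.mem_nhds n) _ ?_⟩,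
    Submodule.projectionOnto_apply_left hCK.symm⟩
  rwa [Submodule.ker_projectionOnto]

end IsLatticeFiltration

theorem exists_continuous_section [IsTopologicalAddGroup V] {R : Submodule k V}
    [DiscreteTopology (V ⧸ R)] : ∃ s : V ⧸ R →L[k] V, ∀ c, Submodule.Quotient.mk (s c) = c := by
  obtain ⟨s, hs⟩ := R.mkQ.exists_rightInverse_of_surjective (Submodule.range_mkQ R)
  exact ⟨⟨s, continuous_of_discreteTopology⟩, fun c => LinearMap.congr_fun hs c⟩

theorem finiteDimensional_quotient_of_sup_eq_top {V : Type*} [AddCommGroup V] [Module k V]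
    {R S : Submodule k V} [FiniteDimensional k S] (h : R ⊔ S = ⊤) :
    FiniteDimensional k (V ⧸ R) := by
  refine Module.Finite.of_surjective (R.mkQ ∘ₗ S.subtype) fun c => ?_
  obtain ⟨v, rfl⟩ := Submodule.Quotient.mk_surjective _ c
  obtain ⟨r, hr, s, hs, rfl⟩ := Submodule.mem_sup.1 (h ▸ Submodule.mem_top : v ∈ R ⊔ S)
  exact ⟨⟨s, hs⟩, ((Submodule.Quotient.eq R).2 (by simpa using hr)).symm⟩

/-- A continuous open map of Tate spaces with finite-dimensional discrete kernel and cokernel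
becomes invertible modulo linearly compact spaces: it is an open surjection onto its image,
followed by the inclusion of a closed subspace. -/
theorem isIso_toElTateModPro_map {W : Type u} [AddCommGroup W] [Module k W] [TopologicalSpace W]
    (hV : IsTateSpace k V) (hW : IsTateSpace k W) (f : V →L[k] W) (hf : IsOpenMap f)
    [FiniteDimensional k (LinearMap.ker f.toLinearMap)]
    [DiscreteTopology (LinearMap.ker f.toLinearMap)]
    [FiniteDimensional k (W ⧸ LinearMap.range f.toLinearMap)]
    [DiscreteTopology (W ⧸ LinearMap.range f.toLinearMap)]
    (hR : IsTateSpace k (LinearMap.range f.toLinearMap)) :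
    IsIso ((toElTateModPro k).map (ElTate.ofHom hV hW f)) := by
  have := hW.isTopologicalAddGroup
  have hopen : IsOpen (LinearMap.range f.toLinearMap : Set W) := hf.isOpen_range
  let π : V →L[k] LinearMap.range f.toLinearMap :=
    ⟨f.toLinearMap.rangeRestrict, f.continuous.subtype_mk _⟩
  let ι : LinearMap.range f.toLinearMap →L[k] W := (LinearMap.range f.toLinearMap).subtypeL
  have hπ : proWeakIso k (ElTate.ofHom hV hR π) := by
    refine Or.inr ⟨⟨f.toLinearMap.surjective_rangeRestrict, π.continuous, ?_⟩, ?_⟩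
    · exact fun U hU => isOpen_induced_iff.2 ⟨f '' U, hf U hU, by
        ext ⟨w, hw⟩
        simp only [Set.mem_preimage, Set.mem_image, Subtype.ext_iff]
        rfl⟩
    · change IsLinearlyCompact k (LinearMap.ker f.toLinearMap.rangeRestrict)
      rw [LinearMap.ker_rangeRestrict]
      exact isLinearlyCompact_of_finiteDimensional
  have hι : proWeakIso k (ElTate.ofHom hR hW ι) := by
    refine Or.inl ⟨?_, ?_⟩
    · exact (AddSubgroup.isClosed_of_isOpen
        (LinearMap.range f.toLinearMap).toAddSubgroup hopen).isClosedEmbedding_subtypeVal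
    · change IsLinearlyCompact k (W ⧸ LinearMap.range (LinearMap.range f.toLinearMap).subtype)
      rw [Submodule.range_subtype]
      exact isLinearlyCompact_of_finiteDimensional
  have hfac : ElTate.ofHom hV hW f = ElTate.ofHom hV hR π ≫ ElTate.ofHom hR hW ι := rfl
  have := (proWeakIso k).Q_inverts _ hπ
  have := (proWeakIso k).Q_inverts _ hι
  rw [hfac, Functor.map_comp]
  infer_instance

end LinearTopology

/-! ### Lattices in finite-dimensional `k((t))`-vector spaces -/

section ModuleTopology

variable {k : Type u} [Field k] {E : Type u} [AddCommGroup E] [Module k E] [Module k⸨X⸩ E]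
  [IsScalarTower k k⸨X⸩ E] [TopologicalSpace E] [IsModuleTopology k⸨X⸩ E]

omit [Module k E] [IsScalarTower k k⸨X⸩ E] in
theorem nhds_zero_of_basis {ι : Type*} [Finite ι] (b : Module.Basis ι k⸨X⸩ E) {U : Set E}
    (hU : U ∈ 𝓝 0) : ∃ n : ℕ, ∀ v, (∀ i, b.repr v i ∈ seriesFrom k n) → v ∈ U := by
  have := Fintype.ofFinite ι
  have := IsModuleTopology.toContinuousAdd k⸨X⸩ E
  have hcont : Continuous fun f : ι → k⸨X⸩ => ∑ i, f i • b i := by fun_prop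
  have hU' := hcont.tendsto 0 (by simpa using hU)
  rw [nhds_pi, Filter.mem_map, Filter.mem_pi'] at hU'
  obtain ⟨I, t, ht, hI⟩ := hU'
  choose m _ hm using fun i => hasBasis_nhds_zero_seriesFrom.mem_iff.1 (ht i)
  -- The sum serves as a common upper bound of all `m i`.
  refine ⟨∑ i, (m i).toNat, fun v hv => ?_⟩
  rw [← b.sum_repr v]
  refine hI fun i _ => hm i (seriesFrom_anti ?_ (hv i))
  have := Finset.single_le_sum (f := fun i => (m i).toNat) (fun _ _ => Nat.zero_le _)
    (Finset.mem_univ i)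
  lia

variable (k E) in
omit [Module k E] [IsScalarTower k k⸨X⸩ E] in
theorem t2Space_of_moduleTopology [FiniteDimensional k⸨X⸩ E] : T2Space E := by
  have := IsModuleTopology.topologicalAddGroup k⸨X⸩ E
  refine .of_injective_continuous (Module.finBasis k⸨X⸩ E).equivFun.injective
    (IsModuleTopology.continuous_of_linearMap (R := k⸨X⸩) _)

/-- A finite-dimensional `k((t))`-vector space is filtered by the lattices `tⁿ k[[t]]ᵈ`. -/
theorem exists_isLatticeFiltration [FiniteDimensional k⸨X⸩ E] :
    ∃ L : ℕ → Submodule k E, IsLatticeFiltration k L := by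
  let b := Module.finBasis k⸨X⸩ E
  let L : ℕ → Submodule k E := fun n =>
    ⨅ i, (seriesFrom k n).comap ((b.coord i).restrictScalars k)
  have hL : ∀ {n v}, v ∈ L n ↔ ∀ i, b.repr v i ∈ seriesFrom k n := by simp [L, Submodule.mem_iInf]
  refine ⟨L, fun i j hij v hv => hL.2 fun l => seriesFrom_anti (by lia) (hL.1 hv l), ?_, ?_, ?_⟩
  · refine Filter.hasBasis_iff.2 fun U => ⟨fun hU => ?_, fun ⟨n, _, hn⟩ => ?_⟩
    · obtain ⟨n, hn⟩ := nhds_zero_of_basis b hU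
      exact ⟨n, trivial, fun v hv => hn v (hL.1 hv)⟩
    · refine Filter.mem_of_superset ?_ hn
      have : ∀ᶠ v in 𝓝 (0 : E), ∀ i, b.coord i v ∈ seriesFrom k n := by
        refine Filter.eventually_all.2 fun i => ?_
        have hc : Continuous (b.coord i) := IsModuleTopology.continuous_of_linearMap _
        exact hc.tendsto' 0 0 (map_zero _) (hasBasis_nhds_zero_seriesFrom.mem_of_mem trivial)
      filter_upwards [this] with v hv
      exact hL.2 hv
  · intro n
    let coeff : ℤ → k⸨X⸩ →ₗ[k] k := fun m =>
      { toFun := fun f => f.coeff m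
        map_add' := fun _ _ => rfl
        map_smul' := fun _ _ => rfl }
    -- On `L 0` the negative coefficients vanish already, so those of degrees `0, …, n - 1` detect
    -- membership in `L n`.
    refine ⟨Fin _ × Fin n, inferInstance,
      LinearMap.pi fun p => coeff p.2 ∘ₗ (b.coord p.1).restrictScalars k, fun v hv hv0 => ?_⟩
    refine hL.2 fun i m hm => ?_
    rcases lt_or_ge m 0 with hm0 | hm0
    · exact hL.1 hv i m hm0
    · have := congrFun hv0 (i, ⟨m.toNat, by lia⟩)
      simpa [coeff, hm0] using this
  · intro v hv
    choose w hw using fun i => exists_limit 0 (fun j => b.repr (v j) i) fun j => by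
      simpa using hL.1 (hv j) i
    refine ⟨∑ i, w i • b i, fun j => hL.2 fun i => ?_⟩
    rw [map_sub, Finsupp.sub_apply, b.repr_sum_self]
    simpa using hw i j

end ModuleTopology

/-! ### Kernel and image of the derivative along `t d/dt` -/

section EulerConnection

variable {k : Type u} [Field k] {E : Type u} [AddCommGroup E] [Module k E] [Module k⸨X⸩ E]
  [IsScalarTower k k⸨X⸩ E]

/-- The covariant derivative of a connection along the Euler vector field `t d/dt`. -/
def IsEulerConnection (D : E →ₗ[k] E) : Prop :=
  ∀ (f : k⸨X⸩) (e : E), D (f • e) = f • D e + euler k f • e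

namespace IsEulerConnection

variable {D : E →ₗ[k] E}

theorem finiteDimensional_ker [CharZero k] [FiniteDimensional k⸨X⸩ E]
    (hD : IsEulerConnection D) : FiniteDimensional k (LinearMap.ker D) := by
  obtain ⟨s, hsK, hspan, hli⟩ := exists_linearIndependent k⸨X⸩ (LinearMap.ker D : Set E)
  have : Fintype s := hli.setFinite.fintype
  suffices LinearMap.ker D ≤ Submodule.span k s by
    have := FiniteDimensional.span_of_finite k s.toFinite
    exact Submodule.finiteDimensional_of_le ‹LinearMap.ker D ≤ Submodule.span k s›
  intro v hv
  have hv' : v ∈ Submodule.span k⸨X⸩ (Set.range ((↑) : s → E)) := by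
    rw [Subtype.range_coe, hspan]
    exact Submodule.subset_span hv
  obtain ⟨c, hc⟩ := (Submodule.mem_span_range_iff_exists_fun k⸨X⸩).1 hv'
  -- Apply `D` to `v = ∑ cᵢ eᵢ` with `v` and all `eᵢ` horizontal: only the terms `θ(cᵢ) eᵢ` survive.
  have hzero : ∑ i, euler k (c i) • (i : E) = 0 := by
    rw [← LinearMap.mem_ker.1 hv, ← hc, map_sum]
    refine Finset.sum_congr rfl fun i _ => ?_
    rw [hD, LinearMap.mem_ker.1 (hsK i.2), smul_zero, zero_add]
  rw [← hc]
  refine sum_mem fun i _ => ?_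
  rw [eq_smul_one_of_euler_eq_zero (Fintype.linearIndependent_iff.1 hli _ hzero i), smul_assoc,
    one_smul]
  exact Submodule.smul_mem _ _ (Submodule.subset_span i.2)

omit [IsScalarTower k k⸨X⸩ E] in
theorem exists_iterate_relation [FiniteDimensional k⸨X⸩ E] (D : E →ₗ[k] E) (e : E) :
    ∃ (n : ℕ) (a : Fin n → k⸨X⸩), a ≠ 0 ∧ ∑ i : Fin n, a i • (D ^ (i : ℕ)) e = 0 := by
  refine ⟨Module.finrank k⸨X⸩ E + 1, ?_⟩
  have hdep : ¬ LinearIndependent k⸨X⸩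
      fun i : Fin (Module.finrank k⸨X⸩ E + 1) => (D ^ (i : ℕ)) e := fun h => by
    have := h.fintype_card_le_finrank
    simp at this
  obtain ⟨a, ha, i, hi⟩ := Fintype.not_linearIndependent_iff.1 hdep
  exact ⟨a, fun h => hi (congrFun h i), ha⟩

variable [TopologicalSpace E] [IsModuleTopology k⸨X⸩ E]

omit [IsScalarTower k k⸨X⸩ E] in
protected theorem continuous [FiniteDimensional k⸨X⸩ E] (hD : IsEulerConnection D) :
    Continuous D := by
  have := IsModuleTopology.toContinuousAdd k⸨X⸩ E
  let b := Module.finBasis k⸨X⸩ E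
  have hb : ∀ i, Continuous (b.coord i) := fun i => IsModuleTopology.continuous_of_linearMap _
  have hD' : D = fun v => ∑ i, (b.coord i v • D (b i) + euler k (b.coord i v) • b i) := by
    funext v
    conv_lhs => rw [← b.sum_repr v, map_sum]
    exact Finset.sum_congr rfl fun i _ => hD _ _
  rw [hD']
  have := isGraded_euler (k := k).continuous
  fun_prop

/-- Integration by parts. -/
theorem exists_pow_neg_euler_smul (hD : IsEulerConnection D) (e : E) (i : ℕ) :
    ∃ w : k⸨X⸩ →ₗ[k] E, Continuous w ∧
      ∀ f, ((-euler k) ^ i) f • e = f • (D ^ i) e + D (w f) := by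
  have := IsModuleTopology.topologicalAddGroup k⸨X⸩ E
  induction i with
  | zero => exact ⟨0, continuous_zero, by simp⟩
  | succ i ih =>
    obtain ⟨w, hw, h⟩ := ih
    -- From `(-θ f) x = f D x - D (f x)` with `x = Dⁱ e`, the new primitive is `w (-θ f) - f Dⁱ e`.
    refine ⟨w ∘ₗ (-euler k) -
      (LinearMap.toSpanSingleton k⸨X⸩ E ((D ^ i) e)).restrictScalars k, ?_, fun f => ?_⟩
    · refine (hw.comp isGraded_euler.neg.continuous).sub ?_
      exact continuous_id.smul continuous_const
    · rw [pow_succ, Module.End.mul_apply, h, LinearMap.sub_apply, map_sub,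
        LinearMap.restrictScalars_apply, LinearMap.toSpanSingleton_apply, hD, pow_succ',
        Module.End.mul_apply, LinearMap.comp_apply, LinearMap.neg_apply, neg_smul]
      abel

/-- For every vector `e` there is a non-zero scalar differential operator `P` such that the
multiples `(P f) e` are images under `D`, by a continuous choice of preimages. -/
theorem exists_isGraded [CharZero k] [FiniteDimensional k⸨X⸩ E] (hD : IsEulerConnection D)
    (e : E) :
    ∃ (P : k⸨X⸩ →ₗ[k] k⸨X⸩) (c : ℤ → k) (w : k⸨X⸩ →ₗ[k] E), IsGraded P c ∧
      {m | c m = 0}.Finite ∧ Continuous w ∧ ∀ f, P f • e = D (w f) := by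
  have := IsModuleTopology.topologicalAddGroup k⸨X⸩ E
  obtain ⟨n, a, ha, hrel⟩ := exists_iterate_relation D e
  obtain ⟨s, hs, hs'⟩ := exists_normalized a ha
  obtain ⟨c, hc, hP⟩ := exists_isGraded_adjoint (fun i => s * a i) hs hs'
  choose w hw h using hD.exists_pow_neg_euler_smul e
  refine ⟨_, c, ∑ i : Fin n, w i ∘ₗ LinearMap.mulLeft k (s * a i), hP, hc, ?_, fun f => ?_⟩
  · simp only [LinearMap.coe_sum, Finset.sum_fn]
    exact continuous_finsetSum _ fun i _ => (hw i).comp (continuous_const.mul continuous_id)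
  · have hrel' : ∑ i : Fin n, (s * a i * f) • (D ^ (i : ℕ)) e = 0 := by
      rw [← smul_zero (f * s), ← hrel, Finset.smul_sum]
      refine Finset.sum_congr rfl fun i _ => ?_
      rw [smul_smul]
      congr 1
      ring
    simp only [LinearMap.sum_apply, LinearMap.comp_apply, LinearMap.mulLeft_apply,
      Finset.sum_smul, h, Finset.sum_add_distrib, hrel', zero_add, map_sum]

theorem isOpenMap [CharZero k] [FiniteDimensional k⸨X⸩ E] (hD : IsEulerConnection D) :
    IsOpenMap D := by
  have := IsModuleTopology.topologicalAddGroup k⸨X⸩ E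
  obtain ⟨L, hL⟩ := exists_isLatticeFiltration (k := k) (E := E)
  refine IsTopologicalAddGroup.isOpenMap_iff_nhds_zero.2 fun U hU => ?_
  obtain ⟨n, -, hn⟩ := hL.hasBasis.mem_iff.1 (Filter.mem_map.1 hU)
  let b := Module.finBasis k⸨X⸩ E
  -- Openness of `P` provides, for each small `f`, a `g` with `P g = f` and `w g ∈ L n`; then `f • b
  -- i = D (w g)`.
  have hmul : ∀ i, ∀ᶠ f in 𝓝 (0 : k⸨X⸩), f • b i ∈ (L n).map D := fun i => by
    obtain ⟨P, c, w, hP, hc, hw, h⟩ := hD.exists_isGraded (b i)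
    have hmem : w ⁻¹' (L n) ∈ 𝓝 0 := hw.tendsto' 0 0 (map_zero w) (hL.mem_nhds n)
    filter_upwards [hP.map_mem_nhds hc hmem] with f hf
    obtain ⟨g, hg, rfl⟩ := hf
    exact ⟨w g, hg, (h g).symm⟩
  have hcoord : ∀ᶠ v in 𝓝 (0 : E), ∀ i, b.repr v i • b i ∈ (L n).map D := by
    refine Filter.eventually_all.2 fun i => ?_
    have hc : Continuous (b.coord i) := IsModuleTopology.continuous_of_linearMap _
    exact (hc.tendsto' 0 0 (map_zero _)).eventually (hmul i)
  filter_upwards [hcoord] with v hv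
  obtain ⟨u, hu, huv⟩ : v ∈ (L n).map D := b.sum_repr v ▸ sum_mem fun i _ => hv i
  exact huv ▸ hn hu

theorem exists_finite_sup_eq_top [CharZero k] [FiniteDimensional k⸨X⸩ E]
    (hD : IsEulerConnection D) :
    ∃ S : Submodule k E, FiniteDimensional k S ∧ LinearMap.range D ⊔ S = ⊤ := by
  let b := Module.finBasis k⸨X⸩ E
  choose P c w hP hc hw h using fun i => hD.exists_isGraded (b i)
  choose S hS hPS using fun i => (hP i).exists_finite_sup_eq_top (hc i)
  let m : ∀ i, k⸨X⸩ →ₗ[k] E := fun i =>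
    (LinearMap.toSpanSingleton k⸨X⸩ E (b i)).restrictScalars k
  refine ⟨⨆ i, (S i).map (m i), Submodule.finite_iSup _, eq_top_iff.2 fun v _ => ?_⟩
  rw [← b.sum_repr v]
  refine sum_mem fun i _ => ?_
  obtain ⟨_, ⟨f, rfl⟩, s, hs, hfs⟩ :=
    Submodule.mem_sup.1 (hPS i ▸ Submodule.mem_top : b.repr v i ∈ LinearMap.range (P i) ⊔ S i)
  rw [← hfs, add_smul, h]
  exact Submodule.add_mem_sup ⟨_, rfl⟩
    (Submodule.mem_iSup_of_mem i (Submodule.mem_map_of_mem (f := m i) hs))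

end IsEulerConnection

end EulerConnection

/-! ### From connections to operators on `E` -/

section Connection

variable {k : Type u} [Field k] {E : Type u} [AddCommGroup E] [Module k E] [Module k⸨X⸩ E]
  [IsScalarTower k k⸨X⸩ E]

/-- The identification `e ⊗ f dt ↦ t f e` of `E ⊗ Ω¹` with `E`, that is, the contraction of forms
with the Euler vector field `t d/dt`. -/
noncomputable def contractEuler (k : Type u) [Field k] (E : Type u) [AddCommGroup E]
    [Module k⸨X⸩ E] : E ⊗[k⸨X⸩] Form k ≃ₗ[k⸨X⸩] E :=
  (TensorProduct.rid k⸨X⸩ E : E ⊗[k⸨X⸩] Form k ≃ₗ[k⸨X⸩] E).trans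
    (LinearEquiv.smulOfNeZero k⸨X⸩ E (HahnSeries.single 1 1) (by simp))

omit [Module k E] [IsScalarTower k k⸨X⸩ E] in
theorem contractEuler_tmul_d (e : E) (f : k⸨X⸩) :
    contractEuler k E (e ⊗ₜ d k f) = euler k f • e := by
  rw [euler_apply, mul_smul]
  rfl

/-- The covariant derivative of a connection along the Euler vector field. -/
noncomputable def Connection.alongEuler (nabla : Connection k E) : E →ₗ[k] E :=
  (contractEuler k E).toLinearMap.restrictScalars k ∘ₗ nabla.toLinearMap

theorem Connection.alongEuler_apply (nabla : Connection k E) (e : E) :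
    nabla.alongEuler e = contractEuler k E (nabla.toLinearMap e) := rfl

theorem Connection.isEulerConnection (nabla : Connection k E) :
    IsEulerConnection nabla.alongEuler := fun f e => by
  rw [alongEuler_apply, nabla.leibniz, map_add, map_smul, contractEuler_tmul_d]
  rfl

end Connection

end FormalConnection

open FormalConnection in
theorem lemma2p2 {k : Type u} [Field k] [CharZero k]
    {E : Type u} [AddCommGroup E] [Module k E] [Module k⸨X⸩ E] [IsScalarTower k k⸨X⸩ E]
    [FiniteDimensional k⸨X⸩ E] [TopologicalSpace E] [IsModuleTopology k⸨X⸩ E]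
    (nabla : FormalConnection.Connection k E) :
    ∃ (hE : FormalConnection.IsTateSpace k E)
      (hEΩ : FormalConnection.IsTateSpace k (E ⊗[k⸨X⸩] FormalConnection.Form k))
      (hcont : Continuous nabla.toLinearMap),
      -- the kernel is finite-dimensional, discrete, and a continuous direct summand
      (FiniteDimensional k (LinearMap.ker nabla.toLinearMap) ∧
        DiscreteTopology (LinearMap.ker nabla.toLinearMap) ∧
        ∃ r : E →L[k] LinearMap.ker nabla.toLinearMap,
          ∀ x : LinearMap.ker nabla.toLinearMap, r x = x) ∧
      -- the same for the cokernel
      (FiniteDimensional k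
          ((E ⊗[k⸨X⸩] FormalConnection.Form k) ⧸ LinearMap.range nabla.toLinearMap) ∧
        DiscreteTopology
          ((E ⊗[k⸨X⸩] FormalConnection.Form k) ⧸ LinearMap.range nabla.toLinearMap) ∧
        ∃ s : ((E ⊗[k⸨X⸩] FormalConnection.Form k) ⧸ LinearMap.range nabla.toLinearMap) →L[k]
            E ⊗[k⸨X⸩] FormalConnection.Form k,
          ∀ c, Submodule.Quotient.mk (s c) = c) ∧
      -- the connection becomes invertible in the localised category
      IsIso ((FormalConnection.toElTateModPro k).map
        (FormalConnection.ElTate.ofHom hE hEΩ ⟨nabla.toLinearMap, hcont⟩)) := by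
  have := IsModuleTopology.topologicalAddGroup k⸨X⸩ E
  have := IsModuleTopology.topologicalAddGroup k⸨X⸩ (E ⊗[k⸨X⸩] Form k)
  let θ := contractEuler k E
  have hθ : Continuous θ := IsModuleTopology.continuous_of_linearMap θ.toLinearMap
  have hθ' : Continuous θ.symm := IsModuleTopology.continuous_of_linearMap θ.symm.toLinearMap
  let θ' : E ≃ₜ E ⊗[k⸨X⸩] Form k := ⟨θ.symm.toEquiv, hθ', hθ⟩
  let θk : E ≃ₗ[k] E ⊗[k⸨X⸩] Form k := θ.symm.restrictScalars k
  have := t2Space_of_moduleTopology k E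
  have : FiniteDimensional k⸨X⸩ (E ⊗[k⸨X⸩] Form k) := Module.Finite.equiv θ.symm
  have := t2Space_of_moduleTopology k (E ⊗[k⸨X⸩] Form k)
  obtain ⟨L, hL⟩ := exists_isLatticeFiltration (k := k) (E := E)
  obtain ⟨M, hM⟩ := exists_isLatticeFiltration (k := k) (E := E ⊗[k⸨X⸩] Form k)
  have hD := nabla.isEulerConnection
  -- `∇` differs from `D` by a linear homeomorphism, so its kernel, cokernel and openness are read
  -- off from `D`.
  have hfac : nabla.toLinearMap = θk.toLinearMap ∘ₗ nabla.alongEuler :=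
    LinearMap.ext fun e => (θ.symm_apply_apply (nabla.toLinearMap e)).symm
  have hcont : Continuous nabla.toLinearMap := hfac ▸ hθ'.comp hD.continuous
  have hopen : IsOpenMap nabla.toLinearMap := hfac ▸ θ'.isOpenMap.comp hD.isOpenMap
  have hker : FiniteDimensional k (LinearMap.ker nabla.toLinearMap) := by
    rw [hfac, LinearEquiv.ker_comp]
    exact hD.finiteDimensional_ker
  have hcoker : FiniteDimensional k
      ((E ⊗[k⸨X⸩] Form k) ⧸ LinearMap.range nabla.toLinearMap) := by
    obtain ⟨S, _, hS⟩ := hD.exists_finite_sup_eq_top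
    refine finiteDimensional_quotient_of_sup_eq_top (S := S.map θk.toLinearMap) ?_
    rw [hfac, LinearMap.range_comp, ← Submodule.map_sup, hS, Submodule.map_top, θk.range]
  have hdisc := hL.discreteTopology_finiteDimensional (LinearMap.ker nabla.toLinearMap)
  have hdisc' : DiscreteTopology ((E ⊗[k⸨X⸩] Form k) ⧸ LinearMap.range nabla.toLinearMap) :=
    QuotientAddGroup.discreteTopology hopen.isOpen_range
  refine ⟨hL.isTateSpace, hM.isTateSpace, hcont,
    ⟨hker, hdisc, hL.exists_retraction_finiteDimensional _⟩,
    ⟨hcoker, hdisc', exists_continuous_section⟩, ?_⟩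
  exact isIso_toElTateModPro_map _ _ ⟨nabla.toLinearMap, hcont⟩ hopen
    (hM.isTateSpace_of_isOpen hopen.isOpen_range)
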